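/- Let $\kappa$ be an infinite cardinal with $\kappa^{\omega}=\kappa$, regarded as the set of ordinals below it. Let $\mathbb T=\mathbb R/\mathbb Z$ and $G=\mathbb Q^{(\kappa)}=\{g\in\mathbb Q^{\kappa}:\operatorname{supp} g\text{ is finite}\}$, and for $C\subseteq\kappa$ let $\mathbb Q^{(C)}=\{g\in G:\operatorname{supp} g\subseteq C\}$. For $\mu\in\kappa$ let $\chi_\mu\in G$ be the element with $\chi_\mu(\mu)=1$ and $\operatorname{supp}\chi_\mu=\{\mu\}$, and let $\chi_{\vec\mu}\in G^{\omega}$ be the constant sequence with value $\chi_\mu$. For an ultrafilter $p$ on $\omega$ and $f\in G^\omega$, let $[f]_p$ be the class of $f$ in the ultrapower $G^\omega/p$ (where $f,g$ are identified iff $\{n:f(n)=g(n)\}\in p$), which is a $\mathbb Q$-vector space. Let $p$ be a selective ultrafilter on $\omega$, i.e. a free ultrafilter such that for every partition $(A_i)_{i\in\omega}$ of $\omega$ with no $A_i$ in $p$ there is $B\in p$ with $|B\cap A_i|\le 1$ for all $i$. Let $\mathcal F\subseteq G^{\omega}$ be a countable (possibly finite) set whose elements are pairwise distinct mod $p$,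 such that $\{[f]_p:f\in\mathcal F\}$ and $\{[\chi_{\vec\mu}]_p:\mu\in\kappa\}$ are disjoint and their union is $\mathbb Q$-linearly independent in $G^\omega/p$. Let $d,d_0,d_1\in G\setminus\{0\}$ have pairwise disjoint supports, and let $C\subseteq\kappa$ be a countably infinite set with $$\omega\cup\operatorname{supp} d\cup\operatorname{supp} d_0\cup\operatorname{supp} d_1\cup\bigcup_{f\in\mathcal F,\,n\in\omega}\operatorname{supp} f(n)\subseteq C.$$ For each $f\in\mathcal F$ let $\xi_f\in C$. Then there is a group homomorphism $\phi:\mathbb Q^{(C)}\to\mathbb T$ such that a) $\phi(d)\neq 0$ and $\phi(d_0)\neq\phi(d_1)$; b) $p\text{-}\lim_{n}\,\phi\bigl(\tfrac1N f(n)\bigr)=\phi\bigl(\tfrac1N\chi_{\xi_f}\bigr)$ for every $f\in\mathcal F$ and every positive integer $N$. -/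

import Mathlib

open Filter Topology Cardinal Ordinal

universe u

/-- A selective ultrafilter on `ω`: a free ultrafilter such that every partition of `ω` into
countably many sets outside `p` has a (partial) selector in `p`. -/
structure IsSelectiveUltrafilter (p : Ultrafilter ℕ) : Prop where
  free : ∀ n : ℕ, ({n} : Set ℕ) ∉ p
  selector : ∀ A : ℕ → Set ℕ, Pairwise (fun i j => Disjoint (A i) (A j)) → (⋃ i, A i) = Set.univ →
    (∀ i, A i ∉ p) → ∃ B ∈ p, ∀ i, (B ∩ A i).Subsingleton

/-- The cardinal `κ` as the set of all ordinals below its initial ordinal. -/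
abbrev CardIndex (κ : Cardinal.{u}) : Type (u + 1) := Set.Iio κ.ord

/-- The group `G = ℚ^(κ)`. -/
abbrev QSum (κ : Cardinal.{u}) : Type (u + 1) := CardIndex κ →₀ ℚ

/-- The element `χ_μ` of `G`. -/
noncomputable def chi {κ : Cardinal.{u}} (μ : CardIndex κ) : QSum κ := Finsupp.single μ 1

/-- The subgroup `ℚ^(C)` of `G`, of the elements with support contained in `C`. -/
abbrev QSumOn {κ : Cardinal.{u}} (C : Set (CardIndex κ)) : Submodule ℚ (QSum κ) :=
  Finsupp.supported ℚ ℚ C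

theorem chi_mem {κ : Cardinal.{u}} {C : Set (CardIndex κ)} {μ : CardIndex κ} (h : μ ∈ C) :
    chi μ ∈ QSumOn C :=
  Finsupp.single_mem_supported ℚ 1 h

/-- The ultrapower `G^ω / p`, with its natural `ℚ`-vector space structure. -/
abbrev QUltrapower (κ : Cardinal.{u}) (p : Ultrafilter ℕ) : Type (u + 1) :=
  Filter.Germ (p : Filter ℕ) (QSum κ)

/-- The class `[f]_p` of a sequence `f`. -/
def ultraClass {κ : Cardinal.{u}} (p : Ultrafilter ℕ) (f : ℕ → QSum κ) : QUltrapower κ p :=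
  (f : Filter.Germ (p : Filter ℕ) (QSum κ))

/-! Linear independence over `ℚ` gives a linear retraction of the ultrapower onto `G` that fixes
constants and sends `[f]_p` to `χ_{ξ_f}` (`exists_retraction`). Composed with it, any character of
`G` becomes a character of the ultrapower that meets every limit condition exactly. Haar averages
transfer this back: integrals over characters of `G` at index `n` converge along `p` to integrals
over characters of the ultrapower, so finitely many approximate conditions are solvable in `G` at
`p`-almost every `n` (`eventually_exists_char`). Selectivity allows successive shrinkings of an open
set of characters to be made along a single member of `p`, and compactness supplies the limit
character (`exists_char_tendsto`). -/

/-! ### Character groups, Haar averages and the ultrapower. -/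

section Characters

open MeasureTheory

variable {X : Type*} [AddCommGroup X]

/-- The topology of pointwise convergence on the group of characters of `X`. -/
instance charTopology : TopologicalSpace (X →+ UnitAddCircle) :=
  TopologicalSpace.induced (fun φ x => φ x) inferInstance

theorem char_isInducing : IsInducing (fun (φ : X →+ UnitAddCircle) (x : X) => φ x) := ⟨rfl⟩

theorem char_isClosedEmbedding :
    IsClosedEmbedding (fun (φ : X →+ UnitAddCircle) (x : X) => φ x) where
  toIsInducing := char_isInducing
  injective := DFunLike.coe_injective
  isClosed_range := AddMonoidHom.isClosed_range_coe X UnitAddCircle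

instance charCompactSpace : CompactSpace (X →+ UnitAddCircle) :=
  char_isClosedEmbedding.compactSpace

instance charIsTopologicalAddGroup : IsTopologicalAddGroup (X →+ UnitAddCircle) :=
  topologicalAddGroup_induced (AddMonoidHom.coeFn X UnitAddCircle)

instance charMeasurableSpace : MeasurableSpace (X →+ UnitAddCircle) := borel _

instance charBorelSpace : BorelSpace (X →+ UnitAddCircle) := ⟨rfl⟩

theorem char_continuous_eval (x : X) : Continuous (fun φ : X →+ UnitAddCircle => φ x) :=
  (continuous_apply x).comp char_isInducing.continuous

/-- The normalized Haar measure on the group of characters of `X`. -/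
noncomputable def charHaar (X : Type*) [AddCommGroup X] : Measure (X →+ UnitAddCircle) :=
  Measure.addHaarMeasure ⊤

instance charHaar_isAddHaarMeasure : (charHaar X).IsAddHaarMeasure :=
  Measure.isAddHaarMeasure_addHaarMeasure _

instance charHaar_isProbabilityMeasure : IsProbabilityMeasure (charHaar X) :=
  ⟨by simpa [charHaar] using Measure.addHaarMeasure_self (K₀ :=
    (⊤ : TopologicalSpace.PositiveCompacts (X →+ UnitAddCircle)))⟩

/-- The character of a rational vector space obtained by reducing a functional modulo `1`. -/
noncomputable def dualChar [Module ℚ X] (l : Module.Dual ℚ X) : X →+ UnitAddCircle :=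
  (QuotientAddGroup.mk' (AddSubgroup.zmultiples (1 : ℝ))).comp
    ((Rat.castHom ℝ).toAddMonoidHom.comp l.toAddMonoidHom)

theorem dualChar_apply [Module ℚ X] (l : Module.Dual ℚ X) (x : X) :
    dualChar l x = ((l x : ℝ) : UnitAddCircle) := rfl

theorem dualChar_ne_zero [Module ℚ X] {l : Module.Dual ℚ X} {x : X} (h : l x = 1 / 2) :
    dualChar l x ≠ 0 := by
  rw [dualChar_apply, h]
  intro h
  rw [AddCircle.coe_eq_zero_iff] at h
  obtain ⟨n, hn⟩ := h
  simp only [zsmul_eq_mul, mul_one] at hn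
  have : ((2 * n : ℤ) : ℝ) = (1 : ℤ) := by push_cast at hn ⊢; linarith
  have := Int.cast_injective this
  omega

theorem exists_char_ne_zero [Module ℚ X] {x : X} (hx : x ≠ 0) :
    ∃ φ : X →+ UnitAddCircle, φ x ≠ 0 := by
  obtain ⟨l, hl⟩ : ∃ l : Module.Dual ℚ X, l x ≠ 0 := by
    by_contra! h
    exact hx ((Module.forall_dual_apply_eq_zero_iff ℚ x).1 h)
  refine ⟨dualChar ((1 / (2 * l x)) • l), dualChar_ne_zero ?_⟩
  rw [LinearMap.smul_apply, _root_.smul_eq_mul]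
  field_simp

/-- Translation by a character `ψ` with `ψ x ≠ 0` multiplies the integral by a number other than
`1`, so invariance forces it to vanish. -/
theorem integral_char_eq [Module ℚ X] [DecidableEq X] (x : X) :
    ∫ φ : X →+ UnitAddCircle, (AddCircle.toCircle (φ x) : ℂ) ∂charHaar X =
      if x = 0 then 1 else 0 := by
  split_ifs with hx
  · simp [hx]
  · obtain ⟨ψ, hψ⟩ := exists_char_ne_zero hx
    have h := integral_add_left_eq_self (μ := charHaar X)
      (fun φ : X →+ UnitAddCircle => (AddCircle.toCircle (φ x) : ℂ)) ψ
    simp only [AddMonoidHom.add_apply, AddCircle.toCircle_add, Circle.coe_mul] at h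
    rw [integral_const_mul] at h
    have hne : (AddCircle.toCircle (ψ x) : ℂ) ≠ 1 := fun h1 => hψ <|
      AddCircle.injective_toCircle one_ne_zero <| Circle.ext <| by simpa using h1
    by_contra h0
    exact hne ((mul_eq_right₀ h0).1 h)

theorem mFourier_char {ι : Type*} [Fintype ι] (b : ι → ℤ) (w : ι → X) (φ : X →+ UnitAddCircle) :
    UnitAddTorus.mFourier b (fun i => φ (w i)) = AddCircle.toCircle (φ (∑ i, b i • w i)) := by
  simp only [UnitAddTorus.mFourier, ContinuousMap.coe_mk, fourier_apply, map_sum, map_zsmul]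
  induction (Finset.univ : Finset ι) using Finset.cons_induction with
  | empty => simp
  | cons i s hi ih => rw [Finset.prod_cons, Finset.sum_cons, ih, AddCircle.toCircle_add]; simp

theorem continuous_char_tuple {ι : Type*} (w : ι → X) :
    Continuous fun (φ : X →+ UnitAddCircle) (i : ι) => φ (w i) :=
  continuous_pi fun i => char_continuous_eval (w i)

theorem integrable_char {ι : Type*} [Fintype ι] (w : ι → X) (g : C(UnitAddTorus ι, ℂ)) :
    Integrable (fun φ : X →+ UnitAddCircle => g fun i => φ (w i)) (charHaar X) :=
  (g.continuous.comp (continuous_char_tuple w)).integrable_of_hasCompactSupport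
    (HasCompactSupport.of_compactSpace _)

theorem norm_integral_char_sub_le {ι : Type*} [Fintype ι] (w : ι → X)
    (g h : C(UnitAddTorus ι, ℂ)) :
    ‖(∫ φ : X →+ UnitAddCircle, g (fun i => φ (w i)) ∂charHaar X) -
      ∫ φ : X →+ UnitAddCircle, h (fun i => φ (w i)) ∂charHaar X‖ ≤ ‖g - h‖ := by
  rw [← integral_sub (integrable_char w g) (integrable_char w h)]
  refine (norm_integral_le_of_norm_le_const (C := ‖g - h‖) (ae_of_all _ fun φ => ?_)).trans ?_
  · exact (g - h).norm_coe_le_norm _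
  · simp

/-- Averages over the characters of the ultrapower are limits of averages over characters. -/
theorem tendsto_integral_char [Module ℚ X] (p : Ultrafilter ℕ) {ι : Type*} [Fintype ι]
    (w : ι → ℕ → X) (g : C(UnitAddTorus ι, ℂ)) :
    Tendsto (fun n => ∫ φ : X →+ UnitAddCircle, g (fun i => φ (w i n)) ∂charHaar X) p
      (𝓝 (∫ Φ : Germ (p : Filter ℕ) X →+ UnitAddCircle,
        g (fun i => Φ (w i : Germ (p : Filter ℕ) X)) ∂charHaar (Germ (p : Filter ℕ) X))) := by
  classical
  -- For a monomial both integrals are `0` or `1`, according to whether an integer combination of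
  -- the `w i` vanishes; the ultrafilter decides this for the sequence.
  have key : ∀ g ∈ Submodule.span ℂ (Set.range (UnitAddTorus.mFourier (d := ι))),
    Tendsto (fun n => ∫ φ : X →+ UnitAddCircle, g (fun i => φ (w i n)) ∂charHaar X) p
      (𝓝 (∫ Φ : Germ (p : Filter ℕ) X →+ UnitAddCircle,
        g (fun i => Φ (w i : Germ (p : Filter ℕ) X)) ∂charHaar (Germ (p : Filter ℕ) X))) := by
    intro g hg
    induction hg using Submodule.span_induction with
    | mem g hg =>
      obtain ⟨b, rfl⟩ := hg
      simp only [mFourier_char, integral_char_eq]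
      have hsum : ∑ i, b i • (w i : Germ (p : Filter ℕ) X) =
          ((fun n => ∑ i, b i • w i n : ℕ → X) : Germ (p : Filter ℕ) X) := by
        have : (fun n => ∑ i, b i • w i n : ℕ → X) = ∑ i, b i • w i := by
          ext n; simp
        rw [this]
        change _ = Germ.coeAddHom (p : Filter ℕ) _
        rw [map_sum]
        simp only [map_zsmul]
        rfl
      rw [hsum]
      refine tendsto_const_nhds.congr' ?_
      by_cases h0 : ((fun n => ∑ i, b i • w i n : ℕ → X) : Germ (p : Filter ℕ) X) = 0
      · rw [if_pos h0]
        filter_upwards [Germ.coe_eq.1 h0] with n hn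
        exact (if_pos hn).symm
      · rw [if_neg h0]
        have : ∀ᶠ n in (p : Filter ℕ), ¬ (∑ i, b i • w i n = 0) :=
          Ultrafilter.eventually_not.2 fun h => h0 (Germ.coe_eq.2 h)
        filter_upwards [this] with n hn
        exact (if_neg hn).symm
    | zero => simp
    | add g h _ _ hg hh =>
      simp only [ContinuousMap.add_apply]
      simp_rw [integral_add (integrable_char _ g) (integrable_char _ h)]
      exact hg.add hh
    | smul c g _ hg =>
      simp only [ContinuousMap.smul_apply, integral_smul]
      exact hg.const_smul c
  have hmem : g ∈ closure (Submodule.span ℂ (Set.range (UnitAddTorus.mFourier (d := ι))) :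
      Set C(UnitAddTorus ι, ℂ)) := by
    rw [← Submodule.topologicalClosure_coe, UnitAddTorus.span_mFourier_closure_eq_top]
    trivial
  rw [Metric.tendsto_nhds]
  intro ε hε
  obtain ⟨h, hh, hgh⟩ := Metric.mem_closure_iff.1 hmem (ε / 3) (by positivity)
  rw [dist_eq_norm] at hgh
  filter_upwards [Metric.tendsto_nhds.1 (key h hh) (ε / 3) (by positivity)] with n hn
  have h1 := norm_integral_char_sub_le (fun i => w i n) g h
  have h2 := norm_integral_char_sub_le (fun i => (w i : Germ (p : Filter ℕ) X)) g h
  rw [← dist_eq_norm] at h1 h2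
  rw [dist_comm] at h2
  refine (dist_triangle4 _ _ _ _).trans_lt (add_lt_add (add_lt_add (h1.trans_lt hgh) hn)
    (h2.trans_lt hgh) |>.trans_eq (by ring))

/-- A Urysohn function supported in `O` and equal to `1` at the tuple of `Φ` has positive average on
the ultrapower side, hence nonzero average at almost every `n`. -/
theorem eventually_exists_char_fintype [Module ℚ X] (p : Ultrafilter ℕ) {ι : Type*} [Fintype ι]
    (w : ι → ℕ → X) (Φ : Germ (p : Filter ℕ) X →+ UnitAddCircle) (O : Set (ι → UnitAddCircle))
    (hO : IsOpen O) (hΦ : (fun i => Φ (w i : Germ (p : Filter ℕ) X)) ∈ O) :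
    ∀ᶠ n in (p : Filter ℕ), ∃ φ : X →+ UnitAddCircle, (fun i => φ (w i n)) ∈ O := by
  obtain ⟨h, h0, h1, h01⟩ := exists_continuous_zero_one_of_isClosed hO.isClosed_compl
    (isClosed_singleton (x := fun i => Φ (w i : Germ (p : Filter ℕ) X)))
    (by simpa using hΦ)
  let g : C(UnitAddTorus ι, ℂ) := ⟨fun y => (h y : ℂ), by fun_prop⟩
  have hlim := tendsto_integral_char p w g
  have hc : Continuous fun Ψ : Germ (p : Filter ℕ) X →+ UnitAddCircle =>
      h (fun i => Ψ (w i : Germ (p : Filter ℕ) X)) :=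
    h.continuous.comp (continuous_char_tuple fun i => (w i : Germ (p : Filter ℕ) X))
  have hpos : 0 < ∫ Ψ : Germ (p : Filter ℕ) X →+ UnitAddCircle,
      h (fun i => Ψ (w i : Germ (p : Filter ℕ) X)) ∂charHaar (Germ (p : Filter ℕ) X) := by
    refine hc.integral_pos_of_hasCompactSupport_nonneg_nonzero
      (HasCompactSupport.of_compactSpace _) (fun Ψ => (h01 _).1) (x := Φ) ?_
    rw [h1 rfl]
    exact one_ne_zero
  have hne : (∫ Ψ : Germ (p : Filter ℕ) X →+ UnitAddCircle,
      g (fun i => Ψ (w i : Germ (p : Filter ℕ) X)) ∂charHaar (Germ (p : Filter ℕ) X)) ≠ 0 := by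
    change (∫ Ψ : Germ (p : Filter ℕ) X →+ UnitAddCircle,
      (h (fun i => Ψ (w i : Germ (p : Filter ℕ) X)) : ℂ) ∂charHaar (Germ (p : Filter ℕ) X)) ≠ 0
    rw [integral_complex_ofReal]
    exact_mod_cast hpos.ne'
  filter_upwards [hlim.eventually_ne hne] with n hn
  by_contra! hcon
  refine hn (integral_eq_zero_of_ae (ae_of_all _ fun φ => ?_))
  change ((h _ : ℝ) : ℂ) = 0
  rw [h0 (hcon φ)]
  simp

/-- Finitely many approximate conditions satisfied by a character of the ultrapower are satisfied
by characters of the group at almost all indices. -/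
theorem eventually_exists_char [Module ℚ X] (p : Ultrafilter ℕ) {ι : Type*}
    (w : ι → ℕ → X) (Φ : Germ (p : Filter ℕ) X →+ UnitAddCircle) (O : Set (ι → UnitAddCircle))
    (hO : IsOpen O) (hΦ : (fun i => Φ (w i : Germ (p : Filter ℕ) X)) ∈ O) :
    ∀ᶠ n in (p : Filter ℕ), ∃ φ : X →+ UnitAddCircle, (fun i => φ (w i n)) ∈ O := by
  obtain ⟨I, v, hv, hI⟩ := isOpen_pi_iff.1 hO _ hΦ
  have h := eventually_exists_char_fintype p (fun i : I => w i) Φ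
    (Set.univ.pi fun i : I => v i) (isOpen_set_pi Set.finite_univ fun i _ => (hv i i.2).1)
    (fun i _ => (hv i i.2).2)
  filter_upwards [h] with n hn
  obtain ⟨φ, hφ⟩ := hn
  exact ⟨φ, hI fun i hi => hφ ⟨i, hi⟩ trivial⟩

end Characters

/-! ### Diagonalization and games on a selective ultrafilter. -/

section Selective

theorem IsSelectiveUltrafilter.infinite_of_mem {p : Ultrafilter ℕ} (hp : IsSelectiveUltrafilter p)
    {s : Set ℕ} (hs : s ∈ p) : s.Infinite := by
  intro hfin
  obtain ⟨n, -, hn⟩ := (Ultrafilter.finite_biUnion_mem_iff (f := p) (s := fun n => {n}) hfin).1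
    (by simpa using hs)
  exact hp.free n hn

/-- Diagonal intersections along a selective ultrafilter. -/
theorem IsSelectiveUltrafilter.exists_diagonal {p : Ultrafilter ℕ} (hp : IsSelectiveUltrafilter p)
    (D : ℕ → Set ℕ) (hDp : ∀ m, D m ∈ p) :
    ∃ B ∈ p, B ⊆ D 0 ∧ ∀ a ∈ B, ∀ b ∈ B, a < b → b ∈ D (a + 1) := by
  classical
  have hfin : ∀ s : Set ℕ, s.Finite → s ∉ p := fun s hs hsp => hp.infinite_of_mem hsp hs
  have hsel : ∀ k : ℕ → ℕ, (∀ i, k ⁻¹' {i} ∉ p) → ∃ B ∈ p, Set.InjOn k B := by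
    intro k hk
    obtain ⟨B, hB, h⟩ := hp.selector (fun i => k ⁻¹' {i})
      (fun i j hij => Set.disjoint_left.2 fun x hx hy => hij (hx.symm.trans hy))
      (by ext; simp) hk
    exact ⟨B, hB, fun x hx y hy hxy => h (k y) ⟨hx, hxy⟩ ⟨hy, rfl⟩⟩
  -- The clause `n ≤ m` only guarantees that a least `m` exists. Injectivity of this `m` on `B₁`
  -- makes `B₁ \ D m` finite for every `m`.
  have hex : ∀ n, ∃ m, n ∉ D m ∨ n ≤ m := fun n => ⟨n, Or.inr le_rfl⟩
  obtain ⟨B₁, hB₁, hinj⟩ := hsel (fun n => Nat.find (hex n)) (by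
    intro i hi
    have h2 : (D i ∩ (Set.Iic i)ᶜ) ∈ p :=
      inter_mem (hDp i) (Ultrafilter.compl_mem_iff_notMem.2 (hfin _ (Set.finite_Iic i)))
    obtain ⟨n, hn, hn1, hn2⟩ := p.nonempty_of_mem (inter_mem hi h2)
    rcases (Nat.find_eq_iff (hex n)).1 hn |>.1 with h | h
    · exact h hn1
    · exact hn2 h)
  have hbound : ∀ m, ∃ N, ∀ n ∈ B₁, N ≤ n → n ∈ D m := by
    intro m
    have hf : (B₁ ∩ {n | n ∉ D m}).Finite := by
      refine Set.Finite.of_finite_image (f := fun n => Nat.find (hex n))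
        ((Set.finite_Iic m).subset ?_) (hinj.mono Set.inter_subset_left)
      rintro _ ⟨n, hn, rfl⟩
      exact Nat.find_min' (hex n) (Or.inl hn.2)
    obtain ⟨N, hN⟩ := hf.bddAbove
    refine ⟨N + 1, fun n hn hNn => ?_⟩
    by_contra h
    have := hN ⟨hn, h⟩
    omega
  choose N hN using hbound
  -- the endpoints of fast growing intervals
  let e : ℕ → ℕ := fun i => Nat.rec 0 (fun _ x => x + 1 + ∑ j ∈ Finset.range (x + 2), N j) i
  have he : ∀ i, e (i + 1) = e i + 1 + ∑ j ∈ Finset.range (e i + 2), N j := fun i => rfl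
  have hemono : StrictMono e := strictMono_nat_of_lt_succ fun i => by rw [he]; omega
  have heN : ∀ i a, a ≤ e i → N (a + 1) ≤ e (i + 1) := by
    intro i a ha
    have : N (a + 1) ≤ ∑ j ∈ Finset.range (e i + 2), N j :=
      Finset.single_le_sum (fun _ _ => Nat.zero_le _) (Finset.mem_range.2 (by omega))
    rw [he]; omega
  have hk : ∀ n, ∃ i, n < e (i + 1) := fun n => ⟨n, (Nat.lt_succ_self n).trans_le (hemono.le_apply)⟩
  let k : ℕ → ℕ := fun n => Nat.find (hk n)
  have hk1 : ∀ n, n < e (k n + 1) := fun n => Nat.find_spec (hk n)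
  have hk2 : ∀ n, e (k n) ≤ n := by
    intro n
    rcases h : k n with _ | j
    · exact Nat.zero_le _
    · exact not_lt.1 (Nat.find_min (hk n) (m := j) (show j < k n by omega))
  obtain ⟨B₂, hB₂, hinj₂⟩ := hsel k (by
    intro i
    refine hfin _ ((Set.finite_Iio (e (i + 1))).subset ?_)
    rintro n rfl
    exact hk1 n)
  have hkmono : ∀ a b, a < b → k a ≤ k b := fun a b hab =>
    Nat.find_min' (hk a) (hab.trans (hk1 b))
  -- `B₂` has at most one point per interval; fixing the parity leaves a whole interval between any
  -- two points, which is long enough to pass `N (a + 1)`.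
  obtain ⟨B₃, hB₃, r, hr⟩ : ∃ B₃ ∈ p, ∃ r, ∀ n ∈ B₃, k n % 2 = r := by
    rcases p.mem_or_compl_mem {n | k n % 2 = 0} with h | h
    · exact ⟨_, h, 0, fun n hn => hn⟩
    · refine ⟨_, h, 1, fun n hn => ?_⟩
      have : ¬ (k n % 2 = 0) := hn
      omega
  refine ⟨B₁ ∩ B₂ ∩ B₃ ∩ D 0, inter_mem (inter_mem (inter_mem hB₁ hB₂) hB₃) (hDp 0),
    Set.inter_subset_right, ?_⟩
  rintro a ⟨⟨⟨-, ha2⟩, ha3⟩, -⟩ b ⟨⟨⟨hb1, hb2⟩, hb3⟩, -⟩ hab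
  have h1 := hkmono a b hab
  have h2 : k a ≠ k b := fun h => hab.ne (hinj₂ ha2 hb2 h)
  have h3 := (hr a ha3).trans (hr b hb3).symm
  have h4 : k a + 2 ≤ k b := by omega
  refine hN (a + 1) b hb1 ((heN (k a + 1) a (hk1 a).le).trans ?_)
  exact (hemono.monotone h4).trans (hk2 b)

/-- In the game on a selective ultrafilter in which one player proposes members of the ultrafilter
and the other picks elements of them, the first player has no strategy that prevents the set of
the picked elements from belonging to the ultrafilter. -/
theorem IsSelectiveUltrafilter.exists_play {p : Ultrafilter ℕ} (hp : IsSelectiveUltrafilter p)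
    {α : Type*} (a₀ : α) (step : α → ℕ → α) (A : α → Set ℕ) (hA : ∀ a, A a ∈ p) :
    ∃ (n : ℕ → ℕ) (s : ℕ → α), Set.range n ∈ p ∧ s 0 = a₀ ∧ (∀ k, s (k + 1) = step (s k) (n k)) ∧
      ∀ k, n k ∈ A (s k) := by
  classical
  -- `S m` holds the positions reachable by increasing picks below `m`. It is finite, so the sets
  -- proposed at all of them can be intersected within `p`.
  let S : ℕ → Finset α := fun m =>
    Nat.rec {a₀} (fun m T => T ∪ T.image fun a => step a m) m
  have hS : ∀ m, S (m + 1) = S m ∪ (S m).image fun a => step a m := fun m => rfl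
  have hSmono : Monotone S := monotone_nat_of_le_succ fun m => by
    rw [hS]; exact Finset.subset_union_left
  obtain ⟨B, hB, hB0, hBD⟩ := hp.exists_diagonal (fun m => ⋂ a ∈ S m, A a)
    (fun m => (biInter_finset_mem (S m)).2 fun a _ => hA a)
  have hinf : B.Infinite := hp.infinite_of_mem hB
  have hmono := Nat.nth_strictMono (p := (· ∈ B)) hinf
  have hmem : ∀ k, Nat.nth (· ∈ B) k ∈ B := fun k => Nat.nth_mem_of_infinite hinf k
  let s : ℕ → α := fun k => Nat.rec a₀ (fun k a => step a (Nat.nth (· ∈ B) k)) k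
  have hs : ∀ k, s (k + 1) = step (s k) (Nat.nth (· ∈ B) k) := fun k => rfl
  have hsS : ∀ k, s (k + 1) ∈ S (Nat.nth (· ∈ B) k + 1) := by
    have aux : ∀ k, s k ∈ S (Nat.nth (· ∈ B) k) → s (k + 1) ∈ S (Nat.nth (· ∈ B) k + 1) := by
      intro k h
      rw [hS, hs]
      exact Finset.mem_union_right _ (Finset.mem_image_of_mem _ h)
    intro k
    induction k with
    | zero => exact aux 0 (hSmono (Nat.zero_le _) (Finset.mem_singleton_self a₀))
    | succ k ih => exact aux _ (hSmono (hmono (Nat.lt_succ_self k)) ih)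
  refine ⟨Nat.nth (· ∈ B), s, ?_, rfl, hs, ?_⟩
  · have : Set.range (Nat.nth (· ∈ B)) = B := Nat.range_nth_of_infinite hinf
    rwa [this]
  · rintro (_ | k)
    · exact Set.mem_iInter₂.1 (hB0 (hmem 0)) _ (Finset.mem_singleton_self a₀)
    · exact Set.mem_iInter₂.1 (hBD _ (hmem k) _ (hmem (k + 1)) (hmono (Nat.lt_succ_self k))) _
        (hsS k)

end Selective

/-! ### Realizing the prescribed limits by one character. -/

/-- Along a selective ultrafilter, the values prescribed by a retraction of the ultrapower onto the
group are realized as limits by a single character, which can be found in any open set. -/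
theorem exists_char_tendsto {X : Type*} [AddCommGroup X] [Module ℚ X] {p : Ultrafilter ℕ}
    (hp : IsSelectiveUltrafilter p) {J : Type*} [Countable J] (a : J → ℕ → X) (b : J → X)
    (π : Germ (p : Filter ℕ) X →+ X)
    (hπc : ∀ x, π ((fun _ => x : ℕ → X) : Germ (p : Filter ℕ) X) = x)
    (hπ : ∀ j, π (a j : Germ (p : Filter ℕ) X) = b j)
    (U : Set (X →+ UnitAddCircle)) (hU : IsOpen U) (hUne : U.Nonempty) :
    ∃ φ ∈ U, ∀ j, Tendsto (fun n => φ (a j n)) p (𝓝 (φ (b j))) := by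
  obtain ⟨enc, henc⟩ := exists_injective_nat J
  let W : ℕ → ℕ → Set (X →+ UnitAddCircle) := fun k n =>
    {φ | ∀ j, enc j < k → dist (φ (a j n)) (φ (b j)) < 1 / ((k : ℝ) + 1)}
  have hfin : ∀ k, {j | enc j < k}.Finite := fun k =>
    (Set.finite_Iio k).preimage henc.injOn
  have hW : ∀ k n, IsOpen (W k n) := by
    intro k n
    have : W k n = ⋂ j ∈ {j | enc j < k},
        {φ | dist (φ (a j n)) (φ (b j)) < 1 / ((k : ℝ) + 1)} := by
      ext; simp [W]
    rw [this]
    exact (hfin k).isOpen_biInter fun j _ => isOpen_lt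
      ((char_continuous_eval _).dist (char_continuous_eval _)) continuous_const
  -- The left summand below carries the constant sequences and so encodes membership in `V`;
  -- `φ₀.comp π` agrees with `φ₀` there and meets the conditions of `W k n` with error zero.
  have hdense : ∀ (k : ℕ) (V : Set (X →+ UnitAddCircle)), IsOpen V → V.Nonempty →
      {n | (V ∩ W k n).Nonempty} ∈ p := by
    rintro k V hV ⟨φ₀, hφ₀⟩
    obtain ⟨V', hV', rfl⟩ := char_isInducing.isOpen_iff.1 hV
    have h := eventually_exists_char p
      (Sum.elim (fun (x : X) (_ : ℕ) => x) a) (φ₀.comp π)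
      ({y | (fun x => y (Sum.inl x)) ∈ V'} ∩ ⋂ j ∈ {j | enc j < k},
        {y | dist (y (Sum.inr j)) (y (Sum.inl (b j))) < 1 / ((k : ℝ) + 1)})
      ((hV'.preimage (by fun_prop)).inter ((hfin k).isOpen_biInter fun j _ =>
        isOpen_lt (by fun_prop) continuous_const)) (by
        refine ⟨?_, Set.mem_iInter₂.2 fun j _ => ?_⟩
        · simpa [hπc] using hφ₀
        · simp only [Set.mem_ofPred_eq, Sum.elim_inr, Sum.elim_inl, AddMonoidHom.comp_apply, hπc, hπ,
            dist_self]
          positivity)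
    filter_upwards [h] with n hn
    obtain ⟨φ, h1, h2⟩ := hn
    exact ⟨φ, h1, fun j hj => Set.mem_iInter₂.1 h2 j hj⟩
  let α := ℕ × {V : Set (X →+ UnitAddCircle) // IsOpen V ∧ V.Nonempty}
  let A : α → Set ℕ := fun s => {n | (s.2.1 ∩ W s.1 n).Nonempty}
  have hshrink : ∀ V : Set (X →+ UnitAddCircle), IsOpen V → V.Nonempty →
      ∃ V' : {V : Set (X →+ UnitAddCircle) // IsOpen V ∧ V.Nonempty}, closure V'.1 ⊆ V := by
    rintro V hV ⟨φ, hφ⟩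
    obtain ⟨T, hT, hTc, hTV⟩ := exists_mem_nhds_isClosed_subset (hV.mem_nhds hφ)
    exact ⟨⟨interior T, isOpen_interior, φ, mem_interior_iff_mem_nhds.2 hT⟩,
      (closure_minimal interior_subset hTc).trans hTV⟩
  -- The first coordinate counts rounds. For `n ∉ A s` the set is kept as a default, which never
  -- occurs in the play.
  have hstep : ∀ (s : α) (n : ℕ), ∃ s' : α, s'.1 = s.1 + 1 ∧
      (n ∈ A s → closure s'.2.1 ⊆ s.2.1 ∩ W s.1 n) := by
    intro s n
    by_cases hn : n ∈ A s
    · obtain ⟨V', hV'⟩ := hshrink _ (s.2.2.1.inter (hW s.1 n)) hn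
      exact ⟨(s.1 + 1, V'), rfl, fun _ => hV'⟩
    · exact ⟨(s.1 + 1, s.2), rfl, fun h => absurd h hn⟩
  choose step hstep1 hstep2 using hstep
  obtain ⟨n, s, hn, hs0, hs, hA⟩ := hp.exists_play (α := α) (0, ⟨U, hU, hUne⟩) step A
    fun s => hdense s.1 s.2.1 s.2.2.1 s.2.2.2
  have hs1 : ∀ k, (s k).1 = k := by
    intro k
    induction k with
    | zero => rw [hs0]
    | succ k ih => rw [hs, hstep1, ih]
  have hcl : ∀ k, closure (s (k + 1)).2.1 ⊆ (s k).2.1 ∩ W k (n k) := by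
    intro k
    have := hstep2 (s k) (n k) (hA k)
    rwa [← hs, hs1] at this
  obtain ⟨φ, hφ⟩ := IsCompact.nonempty_iInter_of_sequence_nonempty_isCompact_isClosed
    (fun k => closure (s k).2.1)
    (fun k => ((hcl k).trans Set.inter_subset_left).trans subset_closure)
    (fun k => (s k).2.2.2.closure) isClosed_closure.isCompact (fun k => isClosed_closure)
  rw [Set.mem_iInter] at hφ
  refine ⟨φ, ?_, fun j => ?_⟩
  · have := (hcl 0 (hφ 1)).1
    rwa [hs0] at this
  · rw [Metric.tendsto_nhds]
    intro ε hε
    obtain ⟨m, hm⟩ := exists_nat_one_div_lt hε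
    let M := max m (enc j + 1)
    -- Discarding the picks of the first `M` rounds leaves those at which condition `j` is already
    -- imposed with error below `ε`.
    have hsmall : (n '' Set.Iio M)ᶜ ∈ p := Ultrafilter.compl_mem_iff_notMem.2 fun h =>
      hp.infinite_of_mem h ((Set.finite_Iio M).image n)
    filter_upwards [hn, hsmall] with i hi hi'
    obtain ⟨k, rfl⟩ := hi
    have hk : M ≤ k := not_lt.1 fun h => hi' ⟨k, h, rfl⟩
    have h1 := (hcl k (hφ (k + 1))).2 j (by omega)
    refine h1.trans_le (le_trans ?_ hm.le)
    have : (m : ℝ) ≤ k := by exact_mod_cast (le_max_left _ _).trans hk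
    gcongr

/-- A retraction of the ultrapower of `G` onto `G` with prescribed values on an independent
family. -/
theorem exists_retraction {κ : Cardinal.{u}} {p : Ultrafilter ℕ} {F : Set (ℕ → QSum κ)}
    (hF_distinct : Set.InjOn (ultraClass p) F)
    (hF_disjoint : Disjoint (ultraClass p '' F)
      (Set.range fun μ : CardIndex κ => ultraClass p fun _ => chi μ))
    (hF_indep : LinearIndepOn ℚ id
      (ultraClass p '' F ∪ Set.range fun μ : CardIndex κ => ultraClass p fun _ => chi μ))
    (η : F → QSum κ) :
    ∃ π : QUltrapower κ p →ₗ[ℚ] QSum κ, (∀ x, π (ultraClass p fun _ => x) = x) ∧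
      ∀ f : F, π (ultraClass p f) = η f := by
  classical
  have hchi : Function.Injective fun μ : CardIndex κ => ultraClass p fun _ => chi μ := by
    intro μ ν h
    exact Finsupp.single_left_injective one_ne_zero (Germ.const_inj.1 h)
  let v : F ⊕ CardIndex κ → QUltrapower κ p :=
    Sum.elim (fun f => ultraClass p f) fun μ => ultraClass p fun _ => chi μ
  have hv : LinearIndependent ℚ v := by
    have hinj : Function.Injective v := by
      refine Function.Injective.sumElim (fun f g h => Subtype.ext (hF_distinct f.2 g.2 h)) hchi ?_
      intro f μ h
      exact Set.disjoint_left.1 hF_disjoint ⟨f, f.2, rfl⟩ ⟨μ, h.symm⟩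
    rw [← linearIndepOn_id_range_iff hinj]
    convert hF_indep using 1
    simp only [v, Set.Sum.elim_range, Set.image_eq_range]
  obtain ⟨π, hπ⟩ : ∃ π : QUltrapower κ p →ₗ[ℚ] QSum κ, ∀ i, π (v i) = Sum.elim η chi i := by
    -- The map is prescribed on the basis of the span and extended to the whole ultrapower.
    obtain ⟨π, hπ⟩ := LinearMap.exists_extend ((Module.Basis.span hv).constr ℚ (Sum.elim η chi))
    refine ⟨π, fun i => ?_⟩
    have h := LinearMap.congr_fun hπ ((Module.Basis.span hv) i)
    rw [Module.Basis.constr_basis, LinearMap.comp_apply, Submodule.subtype_apply,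
      Module.Basis.span_apply] at h
    exact h
  refine ⟨π, fun x => ?_, fun f => hπ (Sum.inl f)⟩
  let c : QSum κ →ₗ[ℚ] QUltrapower κ p :=
    { toFun := fun x => ultraClass p fun _ => x
      map_add' := fun _ _ => rfl
      map_smul' := fun _ _ => rfl }
  have : π.comp c = LinearMap.id := by
    refine Finsupp.lhom_ext' fun μ => LinearMap.ext_ring ?_
    exact hπ (Sum.inr μ)
  exact LinearMap.congr_fun this x

/-- One coordinate from `d` and one from `d₀` suffice: disjointness of supports allows a functional
with value `1/2` at both `d` and `d₀ - d₁`. -/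
theorem exists_char_separating {κ : Cardinal.{u}} {d d₀ d₁ : QSum κ} (hd : d ≠ 0) (hd₀ : d₀ ≠ 0)
    (hdd₀ : Disjoint d.support d₀.support) (hdd₁ : Disjoint d.support d₁.support)
    (hd₀d₁ : Disjoint d₀.support d₁.support) :
    ∃ φ : QSum κ →+ UnitAddCircle, φ d ≠ 0 ∧ φ d₀ ≠ φ d₁ := by
  obtain ⟨μ, hμ⟩ := Finsupp.support_nonempty_iff.2 hd
  obtain ⟨ν, hν⟩ := Finsupp.support_nonempty_iff.2 hd₀
  have h1 : d ν = 0 := Finsupp.notMem_support_iff.1 (Finset.disjoint_right.1 hdd₀ hν)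
  have h2 : d₀ μ = 0 := Finsupp.notMem_support_iff.1 (Finset.disjoint_left.1 hdd₀ hμ)
  have h3 : d₁ μ = 0 := Finsupp.notMem_support_iff.1 (Finset.disjoint_left.1 hdd₁ hμ)
  have h4 : d₁ ν = 0 := Finsupp.notMem_support_iff.1 (Finset.disjoint_left.1 hd₀d₁ hν)
  rw [Finsupp.mem_support_iff] at hμ hν
  let l : Module.Dual ℚ (QSum κ) :=
    (1 / (2 * d μ)) • Finsupp.lapply μ + (1 / (2 * d₀ ν)) • Finsupp.lapply ν
  have hl : ∀ x, l x = 1 / (2 * d μ) * x μ + 1 / (2 * d₀ ν) * x ν := fun x => rfl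
  refine ⟨dualChar l, dualChar_ne_zero ?_, ?_⟩
  · rw [hl, h1]; field_simp; simp
  · rw [← sub_ne_zero, ← map_sub]
    refine dualChar_ne_zero ?_
    rw [map_sub, hl, hl, h2, h3, h4]; field_simp; ring

theorem mainTheorem2 (κ : Cardinal.{u}) (hκ : ℵ₀ ≤ κ) (hκω : κ ^ ℵ₀ = κ)
    (p : Ultrafilter ℕ) (hp : IsSelectiveUltrafilter p)
    (F : Set (ℕ → QSum κ)) (hF : F.Countable)
    (hF_distinct : Set.InjOn (ultraClass p) F)
    (hF_disjoint : Disjoint (ultraClass p '' F)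
      (Set.range fun μ : CardIndex κ => ultraClass p fun _ => chi μ))
    (hF_indep : LinearIndepOn ℚ id
      (ultraClass p '' F ∪ Set.range fun μ : CardIndex κ => ultraClass p fun _ => chi μ))
    (d d₀ d₁ : QSum κ) (hd : d ≠ 0) (hd₀ : d₀ ≠ 0) (hd₁ : d₁ ≠ 0)
    (hdd₀ : Disjoint d.support d₀.support) (hdd₁ : Disjoint d.support d₁.support)
    (hd₀d₁ : Disjoint d₀.support d₁.support)
    (C : Set (CardIndex κ)) (hC : C.Countable) (hC_inf : C.Infinite)
    (hCω : ∀ α : CardIndex κ, (α : Ordinal.{u}) < ω → α ∈ C)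
    (hCd : d ∈ QSumOn C) (hCd₀ : d₀ ∈ QSumOn C) (hCd₁ : d₁ ∈ QSumOn C)
    (hCF : ∀ f ∈ F, ∀ n, f n ∈ QSumOn C)
    (ξ : F → C) :
    ∃ φ : QSumOn C →+ UnitAddCircle,
      φ ⟨d, hCd⟩ ≠ 0 ∧ φ ⟨d₀, hCd₀⟩ ≠ φ ⟨d₁, hCd₁⟩ ∧
      ∀ (f : F) (N : ℕ), 0 < N →
        Tendsto (fun n => φ ((1 / N : ℚ) • ⟨f.1 n, hCF f.1 f.2 n⟩)) (p : Filter ℕ)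
          (𝓝 (φ ((1 / N : ℚ) • ⟨chi (ξ f : CardIndex κ), chi_mem (ξ f).2⟩))) := by
  obtain ⟨π, hπc, hπ⟩ := exists_retraction hF_distinct hF_disjoint hF_indep
    fun f => chi (ξ f : CardIndex κ)
  have : Countable F := hF.to_subtype
  -- Pairs with `N = 0` are harmless, since `1 / 0 = 0` makes their condition trivial. The character
  -- is found on all of `G` and then restricted.
  obtain ⟨φ, ⟨h1, h2⟩, h3⟩ := exists_char_tendsto hp
    (fun (j : F × ℕ) n => (1 / j.2 : ℚ) • j.1.1 n)
    (fun j => (1 / j.2 : ℚ) • chi (ξ j.1 : CardIndex κ)) π.toAddMonoidHom hπc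
    (fun j => (π.map_smul (1 / j.2 : ℚ) (ultraClass p j.1.1)).trans
      (congrArg ((1 / j.2 : ℚ) • ·) (hπ j.1)))
    {φ | φ d ≠ 0 ∧ φ d₀ ≠ φ d₁}
    ((isOpen_ne_fun (char_continuous_eval d) continuous_const).inter
      (isOpen_ne_fun (char_continuous_eval d₀) (char_continuous_eval d₁)))
    (exists_char_separating hd hd₀ hdd₀ hdd₁ hd₀d₁)
  exact ⟨φ.comp (QSumOn C).subtype.toAddMonoidHom, h1, h2, fun f N _ => h3 (f, N)⟩
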